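/- Let $(W,S)$ be a Coxeter system that is simply laced, i.e. $m_{st}\in\{2,3\}$ for all distinct $s,t\in S$, and equip $W$ with the Bruhat order $\le$ (covering relation $\lhd$) and the length function. A \emph{special matching} of a poset $P$ is an involution $\phi:P\to P$ such that for every $u\in P$ one has $u\lhd\phi(u)$ or $\phi(u)\lhd u$, and such that whenever $u\lhd\phi(u)$, $$\{x\in P: x\lhd\phi(u)\}=\{u\}\cup\{\phi(v): v\lhd u,\ v\lhd\phi(v)\}.$$ A \emph{(partial) matching on $W$} is a pair $c=(Q,\phi)$, where $Q\subseteq W$ is closed downwards for $\le$ and $\phi$ is a special matching of the poset $Q$. It is \emph{maximal} if no matching $(Q',\phi')$ with $Q\subsetneq Q'$ has $\phi'|_Q=\phi$. (In particular, a special matching of the whole of $W$ is maximal.) A generator $s\in S$ is \emph{left regular} for $c$ if $sQ\subseteq Q$ and $\phi(sx)=s\phi(x)$ for all $x\in Q$; it is \emph{right regular} if $Qs\subseteq Q$ and $\phi(xs)=\phi(x)s$ for all $x\in Q$. An element $w\in W$ is \emph{full} if for all $s,t\in S$ one has $m_{st}<\infty$ and $M_{st}\le w$, where $M_{st}=sts\cdots$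 ($m_{st}$ factors). The matching $c$ is \emph{reducible} if $|S|\le 2$ or if for every $m\in Q$ such that $m\lhd\phi(m)$ and $\phi(m)$ is full, there is a left regular $s\in S$ with $sm\lhd m$ or a right regular $s\in S$ with $ms\lhd m$. Then every maximal matching $(Q,\phi)$ on $W$ is reducible. In particular, every special matching of $W$ is reducible. -/

import Mathlib

/-- A special matching of a poset `P`: an involution `φ` such that every `u` is comparable with
`φ u` by a covering relation and such that, whenever `u ⋖ φ u`, the coatoms of `φ u` are exactly
`u` and the elements `φ v` with `v ⋖ u` and `v ⋖ φ v`. -/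
structure IsSpecialMatching {P : Type*} [PartialOrder P] (φ : P → P) : Prop where
  involutive : Function.Involutive φ
  covBy_or : ∀ u, u ⋖ φ u ∨ φ u ⋖ u
  coatoms_eq : ∀ u, u ⋖ φ u → {x | x ⋖ φ u} = {u} ∪ φ '' {v | v ⋖ u ∧ v ⋖ φ v}

/-- A partial (special) matching of `P`: a lower set `dom` of `P` together with a special matching
of the subposet `dom`. -/
@[ext]
structure PartialMatching (P : Type*) [PartialOrder P] where
  dom : LowerSet P
  map : dom → dom
  special : IsSpecialMatching map

namespace PartialMatching

variable {P : Type*} [PartialOrder P]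

/-- `c'` extends `c`: the domain of `c` is contained in that of `c'`, and the two maps agree on
the domain of `c`. -/
def Extends (c' c : PartialMatching P) : Prop :=
  ∃ h : ∀ x, x ∈ c.dom → x ∈ c'.dom, ∀ x : c.dom, (c'.map ⟨x, h x x.2⟩ : P) = c.map x

/-- The extension order on partial matchings; `IsMax c` says that `c` is a maximal matching. -/
instance : PartialOrder (PartialMatching P) where
  le c c' := c'.Extends c
  le_refl c := ⟨fun _ hx => hx, fun _ => rfl⟩
  le_trans := by
    rintro c₁ c₂ c₃ ⟨h, hm⟩ ⟨h', hm'⟩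
    refine ⟨fun x hx => h' x (h x hx), fun x => ?_⟩
    rw [← hm x]
    exact hm' ⟨x, h x x.2⟩
  le_antisymm := by
    rintro ⟨d, f, hf⟩ ⟨d', f', hf'⟩ ⟨h, hm⟩ ⟨h', -⟩
    obtain rfl : d = d' := SetLike.ext fun x => ⟨h x, h' x⟩
    obtain rfl : f = f' := funext fun x => Subtype.ext (hm x).symm
    rfl

end PartialMatching

/-- A Coxeter matrix is simply laced if all its off-diagonal entries are `2` or `3`. -/
def CoxeterMatrix.IsSimplyLaced {B : Type*} (M : CoxeterMatrix B) : Prop :=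
  ∀ i j, i ≠ j → M i j = 2 ∨ M i j = 3

namespace CoxeterSystem

variable {B : Type*} {M : CoxeterMatrix B} {W : Type*} [Group W] (cs : CoxeterSystem M W)

/-- The Bruhat order: `x ≤ y` if `y` is reached from `x` by successive right multiplications by
reflections, each of which increases the length. -/
def BruhatLE : W → W → Prop :=
  Relation.ReflTransGen fun u v => ∃ t, cs.IsReflection t ∧ v = u * t ∧ cs.length u < cs.length v

theorem BruhatLE.eq_or_length_lt {x y : W} (h : cs.BruhatLE x y) :
    x = y ∨ cs.length x < cs.length y := by
  induction h with
  | refl => exact Or.inl rfl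
  | tail _ hs ih =>
    obtain ⟨t, -, -, hl⟩ := hs
    rcases ih with rfl | ih
    · exact Or.inr hl
    · exact Or.inr (ih.trans hl)

/-- The Bruhat order as a partial order on `W`. -/
@[reducible]
def bruhatOrder : PartialOrder W where
  le := cs.BruhatLE
  le_refl _ := Relation.ReflTransGen.refl
  le_trans _ _ _ := Relation.ReflTransGen.trans
  le_antisymm x y hxy hyx := by
    rcases BruhatLE.eq_or_length_lt cs hxy with h | h
    · exact h
    · rcases BruhatLE.eq_or_length_lt cs hyx with h' | h'
      · exact h'.symm
      · omega

/-- Partial special matchings of `W` with respect to the Bruhat order. -/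
abbrev Matching : Type _ := @PartialMatching W cs.bruhatOrder

/-- `c` is a maximal matching of `W` (for the extension order). -/
def IsMaximalMatching (c : cs.Matching) : Prop :=
  letI := cs.bruhatOrder
  IsMax c

/-- `w` is full: for all generators `s`, `t`, the order `m_{st}` is finite (encoded as `M i j ≠ 0`)
and the maximal dihedral element `⋯tst` (`m_{st}` factors) is below `w` in the Bruhat order. -/
def IsFull (w : W) : Prop :=
  ∀ i j, M i j ≠ 0 ∧ cs.BruhatLE (cs.wordProd (braidWord M i j)) w

/-- The generator `s_i` is left regular for `c = (Q, φ)`: `Q` is stable under `x ↦ s_i x`, and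
`φ (s_i x) = s_i (φ x)` on `Q`. -/
def IsLeftRegular (c : cs.Matching) (i : B) : Prop :=
  letI := cs.bruhatOrder
  ∃ h : ∀ x, x ∈ c.dom → cs.simple i * x ∈ c.dom,
    ∀ x : c.dom, (c.map ⟨cs.simple i * x, h x x.2⟩ : W) = cs.simple i * c.map x

/-- The generator `s_i` is right regular for `c = (Q, φ)`: `Q` is stable under `x ↦ x s_i`, and
`φ (x s_i) = (φ x) s_i` on `Q`. -/
def IsRightRegular (c : cs.Matching) (i : B) : Prop :=
  letI := cs.bruhatOrder
  ∃ h : ∀ x, x ∈ c.dom → x * cs.simple i ∈ c.dom,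
    ∀ x : c.dom, (c.map ⟨x * cs.simple i, h x x.2⟩ : W) = c.map x * cs.simple i

/-- Reducibility, on the left or on the right, of the orbit `{m, φ m}` with lower element `m`. -/
def IsReducibleOrbit (c : cs.Matching) (m : W) : Prop :=
  (∃ i, cs.IsLeftRegular c i ∧ cs.IsLeftDescent m i) ∨
    (∃ i, cs.IsRightRegular c i ∧ cs.IsRightDescent m i)

/-- A matching `(Q, φ)` is reducible if there are at most two generators, or if every orbit
`{m, φ m}`, with `m ⋖ φ m`, whose upper element `φ m` is full is a reducible orbit. -/
def IsReducible (c : cs.Matching) : Prop :=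
  letI := cs.bruhatOrder
  ENat.card B ≤ 2 ∨
    ∀ m : c.dom, (m : W) ⋖ (c.map m : W) → cs.IsFull (c.map m : W) → cs.IsReducibleOrbit c m

end CoxeterSystem

/-! Let `k = φ(1)`. Multiplication by a generator, on either side, is itself a special matching `f`
of `W`, and regularity of that generator means that `f` and `φ` commute on a domain stable under
`f`. Two facts make this a condition at the identity alone.

Rigidity (`IsMatchingOn.map_comm`): if `f` and `φ` commute at `1`, they commute wherever both
composites make sense. In the essential case of an induction on length, `f (φ x)` and `φ (f x)` have
length at least three and the same coatoms. In simply laced type they are then equal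
(`eq_of_coatoms`); a dihedral subgroup with `m ≥ 4` would break this already in length three.

Extension (`IsMatchingOn.extend`): a matching commuting with `f` extends to `Q ∪ f(Q)`, so a maximal
one already has `f(Q) ⊆ Q`.

Hence `s` in `Q` is left regular if `φ(s) = sk` and right regular if `φ(s) = ks`; since `φ(s)` lies
above `s` and `k` when `s ≠ k`, one of the two holds. If the orbit of `m` is irreducible, `m` has a
left descent `l` with `φ(l) = kl ≠ lk` and a right descent `r` with `φ(r) = rk ≠ kr`. As `k` is
regular on both sides, `φ(lk) = klk` and `φ(kr) = krk`. Fullness puts `klk` below `φ(m)`, which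
forces `k ≤ m` and then `lkr ≤ m`. Now `φ(lkr)` must cover `lkr`, `klk` and `krk`, and no element
does (`not_exists_common_cover`). -/

/-- The map `g` restricts to a special matching of the lower set `Q`. -/
structure IsMatchingOn {P : Type*} [PartialOrder P] (Q : Set P) (g : P → P) : Prop where
  lower : IsLowerSet Q
  mem : ∀ {x}, x ∈ Q → g x ∈ Q
  inv : ∀ {x}, x ∈ Q → g (g x) = x
  covBy_or : ∀ {x}, x ∈ Q → x ⋖ g x ∨ g x ⋖ x
  covBy_iff : ∀ {x}, x ∈ Q → x ⋖ g x →
    ∀ y, y ⋖ g x ↔ y = x ∨ ∃ v, v ⋖ x ∧ v ⋖ g v ∧ g v = y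

/-! ### Special matchings of a graded poset: lifting, rigidity, extension -/

namespace IsMatchingOn

variable {P : Type*} [PartialOrder P] {Q : Set P} {f g : P → P}

theorem map_covBy_map (hg : IsMatchingOn Q g) {x v : P} (hx : x ∈ Q) (h : x ⋖ g x) (hv : v ⋖ x)
    (hv' : v ⋖ g v) : g v ⋖ g x :=
  (hg.covBy_iff hx h _).2 (Or.inr ⟨v, hv, hv', rfl⟩)

/-- An element covered by `y`, with `y` the upper element of its orbit, is `g y` or the upper
element of its orbit. -/
theorem eq_of_covBy (hg : IsMatchingOn Q g) {x y : P} (hy : y ∈ Q) (h : g y ⋖ y) (hxy : x ⋖ y)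
    (hx : x ⋖ g x) : x = g y := by
  have hy' := hg.inv hy
  have h2 : g y ⋖ g (g y) := by rwa [hy']
  rcases (hg.covBy_iff (hg.mem hy) h2 x).1 (by rwa [hy']) with rfl | ⟨v, -, hv, rfl⟩
  · rfl
  · have hvQ : v ∈ Q := hg.lower (hv.le.trans hxy.le) hy
    rw [hg.inv hvQ] at hx
    exact absurd hx.lt hv.lt.not_gt

/-- The lifting property of special matchings. -/
theorem le_or_map_le (hg : IsMatchingOn Q g) (rk : P → ℕ) (hrk : ∀ a b, a ⋖ b → rk b = rk a + 1)
    (hco : ∀ a b : P, a < b → ∃ c, a ≤ c ∧ c ⋖ b) {x y : P} (hx : x ∈ Q) (h : x ⋖ g x)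
    (hy : y ≤ g x) : y ≤ x ∨ g y ≤ x := by
  induction hn : rk x using Nat.strong_induction_on generalizing x with
  | _ n ih =>
    rcases hy.eq_or_lt with rfl | hlt
    · exact Or.inr (hg.inv hx).le
    · obtain ⟨c, hyc, hc⟩ := hco _ _ hlt
      rcases (hg.covBy_iff hx h c).1 hc with rfl | ⟨v, hv, hv', rfl⟩
      · exact Or.inl hyc
      · have := hrk _ _ hv
        exact (ih (rk v) (by omega) (hg.lower hv.le hx) hv' hyc rfl).imp
          (fun h => h.trans hv.le) fun h => h.trans hv.le

/-- A special matching `f` of the whole poset commutes with a partial one as soon as it does so at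
the elements of rank zero, provided that elements of rank at least three are determined by their
coatoms. -/
theorem map_comm (hf : IsMatchingOn Set.univ f) (hg : IsMatchingOn Q g) (rk : P → ℕ)
    (hrk : ∀ a b, a ⋖ b → rk b = rk a + 1)
    (hdet : ∀ a b, 3 ≤ rk a → 3 ≤ rk b → (∀ z, z ⋖ a ↔ z ⋖ b) → a = b)
    (h0 : ∀ x ∈ Q, rk x = 0 → f x ∈ Q → g (f x) = f (g x)) {x : P} (hx : x ∈ Q)
    (hfx : f x ∈ Q) : g (f x) = f (g x) := by
  have hff : ∀ z, f (f z) = z := fun z => hf.inv (Set.mem_univ z)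
  have hfor : ∀ z, z ⋖ f z ∨ f z ⋖ z := fun z => hf.covBy_or (Set.mem_univ z)
  -- The identity at `x` is equivalent to the identity at `f x`, so it suffices to treat the lower
  -- element of each `f`-orbit, by induction on its rank.
  have key : ∀ n, ∀ x ∈ Q, rk x = n → f x ∈ Q → x ⋖ f x → g (f x) = f (g x) := by
    intro n
    induction n using Nat.strong_induction_on with
    | _ n ih =>
    have ih' : ∀ z ∈ Q, f z ∈ Q → rk z < n → z ⋖ f z → g (f z) = f (g z) :=
      fun z hz hfz hzn hzf => ih (rk z) hzn z hz rfl hfz hzf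
    rintro x hx hn hfx hxf
    rcases Nat.eq_zero_or_pos n with rfl | hpos
    · exact h0 x hx hn hfx
    rcases hg.covBy_or hx with hxg | hgx
    · rcases hfor (g x) with hup | hdown
      · have hne : ¬ g (f x) ⋖ f x := by
          intro hlow
          rcases (hf.covBy_iff (Set.mem_univ x) hxf _).1 hlow with heq | ⟨z, hz, hzf, heq⟩
          · have : f x = g x := by rw [← hg.inv hfx, heq]
            rw [← this, hff] at hup
            exact hup.lt.not_gt hxf.lt
          · have hfzQ : f z ∈ Q := heq ▸ hg.mem hfx
            have hzQ := hg.lower hz.le hx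
            have h1 := ih' z hzQ hfzQ (by have := hrk _ _ hz; omega) hzf
            rw [heq, hg.inv hfx] at h1
            have h2 : g x = z := by
              rw [← hff x, h1, hff, hg.inv hzQ]
            rw [h2] at hxg
            exact hxg.lt.not_gt hz.lt
        have hfg : f x ⋖ g (f x) := (hg.covBy_or hfx).resolve_right hne
        have r1 := hrk _ _ hxg
        have r2 := hrk _ _ hup
        have r3 := hrk _ _ hxf
        have r4 := hrk _ _ hfg
        -- Both elements have rank `n + 2`, which is at least three because rank zero was set aside.
        -- Their coatoms agree by the induction hypothesis at elements `z` covered by `x`; rank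
        -- counts show that `f` and `g` go up where required.
        refine hdet _ _ (by omega) (by omega) fun y => ?_
        rw [hg.covBy_iff hfx hfg, hf.covBy_iff (Set.mem_univ _) hup]
        constructor
        · rintro (rfl | ⟨v, hv, hvg, rfl⟩)
          · exact Or.inr ⟨x, hxg, hxf, rfl⟩
          · rcases (hf.covBy_iff (Set.mem_univ x) hxf _).1 hv with rfl | ⟨z, hz, hzf, rfl⟩
            · exact Or.inl rfl
            · have hzQ := hg.lower hz.le hx
              have hfzQ := hg.lower hv.le hfx
              have h1 := ih' z hzQ hfzQ (by have := hrk _ _ hz; omega) hzf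
              rw [h1] at hvg ⊢
              have q1 := hrk _ _ hvg
              have q2 := hrk _ _ hzf
              have hzg : z ⋖ g z := by
                refine (hg.covBy_or hzQ).resolve_right fun h => ?_
                have q3 := hrk _ _ h
                rcases hfor (g z) with h' | h' <;> have q4 := hrk _ _ h' <;> omega
              refine Or.inr ⟨g z, hg.map_covBy_map hx hxg hz hzg, ?_, rfl⟩
              refine (hfor (g z)).resolve_right fun h' => ?_
              have q3 := hrk _ _ hzg
              have q4 := hrk _ _ h'
              omega
        · rintro (rfl | ⟨v, hv, hvf, rfl⟩)
          · exact Or.inr ⟨x, hxf, hxg, rfl⟩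
          · rcases (hg.covBy_iff hx hxg _).1 hv with rfl | ⟨z, hz, hzg, rfl⟩
            · exact Or.inl rfl
            · have hzQ := hg.lower hz.le hx
              have p1 := hrk _ _ hz
              have p2 := hrk _ _ hzg
              have p3 := hrk _ _ hvf
              have hzf : z ⋖ f z := by
                refine (hfor z).resolve_right fun h => ?_
                have hfzQ := hg.lower h.le hzQ
                have p4 := hrk _ _ h
                have h1 := ih' (f z) hfzQ (by rwa [hff]) (by omega) (by rwa [hff])
                rw [hff] at h1
                rw [h1, hff] at hvf
                rw [h1] at p3 p2
                rw [hff] at p3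
                rcases hg.covBy_or hfzQ with h' | h' <;> have p5 := hrk _ _ h' <;> omega
              have hfzx := hf.map_covBy_map (Set.mem_univ x) hxf hz hzf
              have hfzQ := hg.lower hfzx.le hfx
              have h1 := ih' z hzQ hfzQ (by omega) hzf
              have p4 := hrk _ _ hzf
              refine Or.inr ⟨f z, hfzx, ?_, h1⟩
              refine (hg.covBy_or hfzQ).resolve_right fun h' => ?_
              rw [h1] at h'
              have p5 := hrk _ _ h'
              omega
      -- Here `x` is the lower element of its `f`-orbit and is covered by the upper element `g x` of
      -- another orbit description, so the two orbits coincide and `f x = g x`.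
      · have := hf.eq_of_covBy (Set.mem_univ (g x)) hdown hxg hxf
        have e : f x = g x := by conv_lhs => rw [this, hff]
        rw [e, hg.inv hx]
        exact this
    -- If `g x ⋖ x`, the induction hypothesis at the lower of `g x` and `f (g x)` gives the identity
    -- after applying the involutions.
    · have hyQ := hg.mem hx
      have q := hrk _ _ hgx
      rcases hfor (g x) with hup | hdown
      · have h1 := hf.map_covBy_map (Set.mem_univ x) hxf hgx hup
        have hfyQ := hg.lower h1.le hfx
        have h2 := ih' (g x) hyQ hfyQ (by omega) hup
        rw [hg.inv hx] at h2
        rw [← h2, hg.inv hfyQ]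
      · have hzQ := hg.lower hdown.le hyQ
        have q2 := hrk _ _ hdown
        have h2 := ih' (f (g x)) hzQ (by rwa [hff]) (by omega) (by rwa [hff])
        rw [hff, hg.inv hx] at h2
        have e : f x = g (f (g x)) := by conv_lhs => rw [h2, hff]
        rw [e, hg.inv hzQ]
  rcases hfor x with h | h
  · exact key _ x hx rfl hfx h
  · have := key _ (f x) hfx rfl (by rwa [hff]) (by rwa [hff])
    rw [hff] at this
    rw [this, hff]

open Classical in
/-- A partial matching that commutes with a special matching `f` of the whole poset extends to
a domain stable under `f`. -/
theorem extend (hf : IsMatchingOn Set.univ f) (hg : IsMatchingOn Q g) (rk : P → ℕ)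
    (hrk : ∀ a b, a ⋖ b → rk b = rk a + 1) (hco : ∀ a b : P, a < b → ∃ c, a ≤ c ∧ c ⋖ b)
    (hcomm : ∀ x ∈ Q, f x ∈ Q → g (f x) = f (g x)) :
    IsMatchingOn {x | x ∈ Q ∨ f x ∈ Q} fun x => if x ∈ Q then g x else f (g (f x)) := by
  have hff : ∀ z, f (f z) = z := fun z => hf.inv (Set.mem_univ z)
  have hfor : ∀ z, z ⋖ f z ∨ f z ⋖ z := fun z => hf.covBy_or (Set.mem_univ z)
  set k : P → P := fun x => if x ∈ Q then g x else f (g (f x)) with hk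
  have k1 : ∀ {x}, x ∈ Q → k x = g x := fun h => if_pos h
  have k2 : ∀ {x}, x ∈ Q → k (f x) = f (g x) := by
    intro x hx
    by_cases h : f x ∈ Q
    · rw [k1 h, hcomm x hx h]
    · simp only [hk, if_neg h, hff]
  have hnot : ∀ {x}, x ∈ Q → f x ∉ Q → f (g x) ∉ Q := by
    intro x hx hfx h
    apply hfx
    have := hcomm _ (hg.mem hx) h
    rw [hg.inv hx] at this
    exact this ▸ hg.mem h
  have hout : ∀ {x}, x ∈ Q → f x ∉ Q → x ⋖ f x := fun {x} hx hfx =>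
    (hfor x).resolve_right fun h => hfx (hg.lower h.le hx)
  have hcov : ∀ {x y}, x ⋖ f x → y ⋖ f y → x ⋖ y → f x ⋖ f y := fun hx hy hxy =>
    hf.map_covBy_map (Set.mem_univ _) hy hxy hx
  refine ⟨?_, ?_, ?_, ?_, ?_⟩
  -- The new domain is a lower set by the lifting property of `f`: below `f u` with `u ∈ Q`, either
  -- `x ≤ u` or `f x ≤ u`.
  · intro y x hxy hy
    by_cases hyQ : y ∈ Q
    · exact Or.inl (hg.lower hxy hyQ)
    have hy' : f y ∈ Q := hy.resolve_left hyQ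
    have hlt := hout hy' (by rwa [hff])
    rcases hf.le_or_map_le rk hrk hco (Set.mem_univ (f y)) hlt (y := x) (by rwa [hff]) with h | h
    · exact Or.inl (hg.lower h hy')
    · exact Or.inr (hg.lower h hy')
  · rintro x (hx | hx)
    · rw [k1 hx]; exact Or.inl (hg.mem hx)
    · have := k2 hx
      rw [hff] at this
      rw [this]
      exact Or.inr (by rw [hff]; exact hg.mem hx)
  · rintro x (hx | hx)
    · rw [k1 hx, k1 (hg.mem hx), hg.inv hx]
    · have := k2 hx
      rw [hff] at this
      rw [this, k2 (hg.mem hx), hg.inv hx, hff]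
  · rintro x hx
    by_cases hxQ : x ∈ Q
    · rw [k1 hxQ]; exact hg.covBy_or hxQ
    have hx' : f x ∈ Q := hx.resolve_left hxQ
    obtain ⟨u, rfl⟩ : ∃ u, f u = x := ⟨f x, hff x⟩
    rw [hff] at hx'
    rw [k2 hx']
    have h1 := hout hx' hxQ
    have h2 := hout (hg.mem hx') (hnot hx' hxQ)
    exact (hg.covBy_or hx').imp (hcov h1 h2) (hcov h2 h1)
  · rintro x hx hxk y
    by_cases hxQ : x ∈ Q
    · rw [k1 hxQ] at hxk ⊢
      rw [hg.covBy_iff hxQ hxk]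
      refine or_congr_right (exists_congr fun v => and_congr_right fun hv => ?_)
      rw [k1 (hg.lower hv.le hxQ)]
    -- Outside `Q`, write `x = f u` with `u ∈ Q`. The coatoms of `f (g u)` are described by `f` from
    -- those of `g u`, and must be re-expressed through coatoms of `f u`; commutation and rank
    -- counts match `f (g z)` with `z ⋖ u` on both sides.
    have hx' : f x ∈ Q := hx.resolve_left hxQ
    obtain ⟨u, rfl⟩ : ∃ u, f u = x := ⟨f x, hff x⟩
    rw [hff] at hx'
    rw [k2 hx'] at hxk ⊢
    have huf := hout hx' hxQ
    have hguf := hout (hg.mem hx') (hnot hx' hxQ)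
    have r1 := hrk _ _ huf
    have r2 := hrk _ _ hguf
    have r3 := hrk _ _ hxk
    have hug : u ⋖ g u := (hg.covBy_or hx').resolve_right fun h => by
      have := hrk _ _ h; omega
    rw [hf.covBy_iff (Set.mem_univ _) hguf]
    constructor
    · rintro (rfl | ⟨v, hv, hvf, rfl⟩)
      · exact Or.inr ⟨u, huf, by rwa [k1 hx'], k1 hx'⟩
      · rcases (hg.covBy_iff hx' hug _).1 hv with rfl | ⟨z, hz, hzg, rfl⟩
        · exact Or.inl rfl
        · have hzQ := hg.lower hz.le hx'
          have s1 := hrk _ _ hzg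
          have s2 := hrk _ _ hvf
          have hzf : z ⋖ f z := by
            refine (hfor z).resolve_right fun h => ?_
            have hfz := hg.lower h.le hzQ
            have s3 := hrk _ _ h
            rw [← hcomm z hzQ hfz] at s2
            rcases hg.covBy_or hfz with h' | h' <;> have s4 := hrk _ _ h' <;> omega
          refine Or.inr ⟨f z, hcov hzf huf hz, ?_, k2 hzQ⟩
          rw [k2 hzQ]
          exact hcov hzf hvf hzg
    · rintro (rfl | ⟨v, hv, hvk, rfl⟩)
      · exact Or.inr ⟨u, hug, huf, rfl⟩
      · rcases (hf.covBy_iff (Set.mem_univ _) huf _).1 hv with rfl | ⟨z, hz, hzf, rfl⟩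
        · exact Or.inl (k1 hx')
        · have hzQ := hg.lower hz.le hx'
          rw [k2 hzQ] at hvk ⊢
          have s1 := hrk _ _ hvk
          have s2 := hrk _ _ hzf
          have hzg : z ⋖ g z := (hg.covBy_or hzQ).resolve_right fun h => by
            have s3 := hrk _ _ h
            rcases hfor (g z) with h' | h' <;> have s4 := hrk _ _ h' <;> omega
          have s3 := hrk _ _ hzg
          refine Or.inr ⟨g z, hg.map_covBy_map hx' hug hz hzg, ?_, rfl⟩
          exact (hfor (g z)).resolve_right fun h => by have := hrk _ _ h; omega

end IsMatchingOn

/-! ### Partial matchings as maps on the ambient poset -/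

namespace PartialMatching

variable {P : Type*} [PartialOrder P]

theorem covBy_coe_iff {Q : LowerSet P} {x y : Q} : (x : P) ⋖ y ↔ x ⋖ y := by
  refine ⟨fun h => ⟨h.1, fun z h1 h2 => h.2 (c := z) h1 h2⟩, fun h => ⟨h.1, fun z h1 h2 => ?_⟩⟩
  exact h.2 (c := ⟨z, Q.lower h2.le y.2⟩) h1 h2

open Classical in
/-- The map of a partial matching, extended by the identity. -/
noncomputable def total (c : PartialMatching P) (x : P) : P :=
  if h : x ∈ c.dom then c.map ⟨x, h⟩ else x

theorem total_of_mem (c : PartialMatching P) {x : P} (h : x ∈ c.dom) :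
    c.total x = c.map ⟨x, h⟩ := dif_pos h

theorem total_coe (c : PartialMatching P) (x : c.dom) : c.total x = c.map x :=
  c.total_of_mem x.2

theorem isMatchingOn_total (c : PartialMatching P) : IsMatchingOn (c.dom : Set P) c.total where
  lower := c.dom.lower
  mem {x} hx := by rw [c.total_of_mem hx]; exact (c.map ⟨x, hx⟩).2
  inv {x} hx := by rw [c.total_of_mem hx, c.total_coe, c.special.involutive]
  covBy_or {x} hx := by
    rw [c.total_of_mem hx]
    exact (c.special.covBy_or ⟨x, hx⟩).imp covBy_coe_iff.2 covBy_coe_iff.2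
  covBy_iff {x} hx h y := by
    rw [c.total_of_mem hx] at h ⊢
    have := c.special.coatoms_eq ⟨x, hx⟩ (covBy_coe_iff.1 h)
    rw [Set.ext_iff] at this
    constructor
    · intro hy
      have hyQ := c.dom.lower hy.le (c.map ⟨x, hx⟩).2
      rcases (this ⟨y, hyQ⟩).1 (covBy_coe_iff.1 hy) with h1 | ⟨v, ⟨h1, h2⟩, h3⟩
      · exact Or.inl (congrArg Subtype.val h1)
      · exact Or.inr ⟨v, covBy_coe_iff.2 h1, by rw [c.total_coe]; exact covBy_coe_iff.2 h2,
          by rw [c.total_coe, h3]⟩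
    · rintro (rfl | ⟨v, h1, h2, rfl⟩)
      · exact h
      · have hv := c.dom.lower h1.le hx
        rw [c.total_of_mem hv] at h2 ⊢
        exact covBy_coe_iff.2 ((this _).2 (Or.inr ⟨⟨v, hv⟩,
          ⟨covBy_coe_iff.1 h1, covBy_coe_iff.1 h2⟩, rfl⟩))

end PartialMatching

/-- The partial matching with domain `Q` and map `g`. -/
def IsMatchingOn.toPartialMatching {P : Type*} [PartialOrder P] {Q : Set P} {g : P → P}
    (hg : IsMatchingOn Q g) : PartialMatching P where
  dom := ⟨Q, hg.lower⟩
  map x := ⟨g x, hg.mem x.2⟩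
  special :=
    { involutive := fun x => Subtype.ext (hg.inv x.2)
      covBy_or := fun x => (hg.covBy_or x.2).imp PartialMatching.covBy_coe_iff.1
        PartialMatching.covBy_coe_iff.1
      coatoms_eq := fun x hx => by
        ext y
        have := hg.covBy_iff x.2 (PartialMatching.covBy_coe_iff.2 hx) y
        rw [Set.mem_ofPred_eq, ← PartialMatching.covBy_coe_iff]
        refine this.trans (or_congr ⟨fun h => Subtype.ext h, fun h => congrArg Subtype.val h⟩
          ⟨?_, ?_⟩)
        · rintro ⟨v, h1, h2, h3⟩
          exact ⟨⟨v, hg.lower h1.le x.2⟩, ⟨PartialMatching.covBy_coe_iff.1 h1,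
            PartialMatching.covBy_coe_iff.1 h2⟩, Subtype.ext h3⟩
        · rintro ⟨v, ⟨h1, h2⟩, h3⟩
          exact ⟨v, PartialMatching.covBy_coe_iff.2 h1, PartialMatching.covBy_coe_iff.2 h2,
            congrArg Subtype.val h3⟩ }

/-- The domain of a maximal matching is stable under every special matching of the whole poset
that commutes with it. -/
theorem PartialMatching.map_mem_of_isMax {P : Type*} [PartialOrder P] {c : PartialMatching P}
    (hc : IsMax c) {f : P → P} (hf : IsMatchingOn Set.univ f) (rk : P → ℕ)
    (hrk : ∀ a b, a ⋖ b → rk b = rk a + 1) (hco : ∀ a b : P, a < b → ∃ c, a ≤ c ∧ c ⋖ b)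
    (hcomm : ∀ x ∈ c.dom, f x ∈ c.dom → c.total (f x) = f (c.total x)) {x : P}
    (hx : x ∈ c.dom) : f x ∈ c.dom := by
  have h := hf.extend c.isMatchingOn_total rk hrk hco hcomm
  have hle : c ≤ h.toPartialMatching := by
    refine ⟨fun x hx => Or.inl hx, fun x => ?_⟩
    have : (x : P) ∈ (c.dom : Set P) := x.2
    exact (if_pos this).trans (c.total_coe x)
  obtain ⟨h', -⟩ := hc hle
  exact h' (f x) (Or.inr (by rwa [hf.inv (Set.mem_univ x)]))

/-! ### Simply laced Coxeter relations -/

namespace CoxeterSystem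

variable {B : Type*} {M : CoxeterMatrix B} {W : Type*} [Group W] (cs : CoxeterSystem M W)

theorem simple_comm_of_eq_two {i j : B} (h : M i j = 2) :
    cs.simple i * cs.simple j = cs.simple j * cs.simple i := by
  have := cs.simple_mul_simple_pow i j
  rw [h, pow_two] at this
  rw [mul_eq_one_iff_eq_inv.1 this, mul_inv_rev, inv_simple, inv_simple]

theorem simple_braid_of_eq_three {i j : B} (h : M i j = 3) :
    cs.simple i * (cs.simple j * cs.simple i) = cs.simple j * (cs.simple i * cs.simple j) := by
  have := cs.simple_mul_simple_pow i j
  rw [h, pow_three] at this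
  have h2 : (cs.simple i * (cs.simple j * cs.simple i)) *
      (cs.simple j * (cs.simple i * cs.simple j)) = 1 := by
    rw [← this]; simp only [mul_assoc]
  rw [mul_eq_one_iff_eq_inv.1 h2]
  simp [mul_assoc]

end CoxeterSystem

theorem CoxeterMatrix.IsSimplyLaced.isLiftable {B : Type*} {M : CoxeterMatrix B}
    (hM : M.IsSimplyLaced) {G : Type*} [Monoid G] (f : B → G) (h1 : ∀ i, f i * f i = 1)
    (h2 : ∀ i j, M i j = 2 → f i * f j = f j * f i)
    (h3 : ∀ i j, M i j = 3 → f i * (f j * f i) = f j * (f i * f j)) : M.IsLiftable f := by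
  intro i j
  have h1' : ∀ i x, f i * (f i * x) = x := fun i x => by rw [← mul_assoc, h1, one_mul]
  by_cases hij : i = j
  · subst hij
    rw [h1, one_pow]
  rcases hM i j hij with h | h
  · rw [h, pow_two]
    nth_rw 2 [h2 i j h]
    rw [mul_assoc, h1', h1]
  · rw [h, pow_three]
    calc f i * f j * (f i * f j * (f i * f j))
        = (f i * (f j * f i)) * (f j * (f i * f j)) := by simp only [mul_assoc]
      _ = 1 := by rw [h3 i j h]; simp only [mul_assoc, h1', h1]

namespace CoxeterSystem

variable {B : Type*} {M : CoxeterMatrix B} {W : Type*} [Group W] (cs : CoxeterSystem M W)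

/-! ### The reflection cocycle and lifting in the Bruhat order -/

open Classical in
/-- The action of a generator on signed group elements. -/
noncomputable def signedConj (i : B) (p : W × ZMod 2) : W × ZMod 2 :=
  (cs.simple i * p.1 * cs.simple i, p.2 + if p.1 = cs.simple i then 1 else 0)

theorem simple_conj_eq_iff (i : B) (x y : W) :
    cs.simple i * x * cs.simple i = y ↔ x = cs.simple i * y * cs.simple i := by
  constructor <;> rintro rfl <;> simp [mul_assoc]

open Classical in
theorem signedConj_mk (i : B) (x : W) (e : ZMod 2) :
    cs.signedConj i (x, e) =
      (cs.simple i * x * cs.simple i, e + if x = cs.simple i then 1 else 0) := rfl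

open Classical in
theorem isLiftable_signedConj (hM : M.IsSimplyLaced) :
    M.IsLiftable (G := Function.End (W × ZMod 2)) cs.signedConj := by
  have two : (1 : ZMod 2) + 1 = 0 := by decide
  refine hM.isLiftable _ (fun i => ?_) (fun i j h => ?_) (fun i j h => ?_)
  · funext ⟨x, e⟩
    change cs.signedConj i (cs.signedConj i (x, e)) = (x, e)
    have c : (if cs.simple i * x * cs.simple i = cs.simple i
        then (1 : ZMod 2) else 0) =
        if x = cs.simple i then 1 else 0 := by
      refine if_congr ?_ rfl rfl
      rw [simple_conj_eq_iff, simple_mul_simple_self, one_mul]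
    simp only [signedConj_mk, c, Prod.mk.injEq]
    refine ⟨by simp [mul_assoc], ?_⟩
    split_ifs
    · rw [add_assoc, two, add_zero]
    · simp
  · funext ⟨x, e⟩
    change cs.signedConj i (cs.signedConj j (x, e)) = cs.signedConj j (cs.signedConj i (x, e))
    have hc := cs.simple_comm_of_eq_two h
    have ci : (if cs.simple j * x * cs.simple j = cs.simple i
        then (1 : ZMod 2) else 0) =
        if x = cs.simple i then 1 else 0 := by
      refine if_congr ?_ rfl rfl
      rw [simple_conj_eq_iff, ← hc, simple_mul_simple_cancel_right]
    have cj : (if cs.simple i * x * cs.simple i = cs.simple j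
        then (1 : ZMod 2) else 0) =
        if x = cs.simple j then 1 else 0 := by
      refine if_congr ?_ rfl rfl
      rw [simple_conj_eq_iff, hc, simple_mul_simple_cancel_right]
    simp only [signedConj_mk, ci, cj, Prod.mk.injEq]
    refine ⟨?_, by ring⟩
    calc _ = (cs.simple i * cs.simple j) * x * (cs.simple j * cs.simple i) := by
          simp only [mul_assoc]
      _ = (cs.simple j * cs.simple i) * x * (cs.simple i * cs.simple j) := by rw [hc]
      _ = _ := by simp only [mul_assoc]
  · funext ⟨x, e⟩
    change cs.signedConj i (cs.signedConj j (cs.signedConj i (x, e))) =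
      cs.signedConj j (cs.signedConj i (cs.signedConj j (x, e)))
    have hb := cs.simple_braid_of_eq_three h
    have hb' : cs.simple i * cs.simple j * cs.simple i =
      cs.simple j * cs.simple i * cs.simple j := by simpa only [mul_assoc] using hb
    have ci : (if cs.simple j * (cs.simple i * x * cs.simple i) * cs.simple j = cs.simple i
        then (1 : ZMod 2) else 0) =
        if x = cs.simple j then 1 else 0 := by
      refine if_congr ?_ rfl rfl
      rw [simple_conj_eq_iff, simple_conj_eq_iff, ← hb']; simp [mul_assoc]
    have cj : (if cs.simple i * (cs.simple j * x * cs.simple j) * cs.simple i = cs.simple j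
        then (1 : ZMod 2) else 0) =
        if x = cs.simple i then 1 else 0 := by
      refine if_congr ?_ rfl rfl
      rw [simple_conj_eq_iff, simple_conj_eq_iff, hb']; simp [mul_assoc]
    have cij : (if cs.simple i * x * cs.simple i = cs.simple j
        then (1 : ZMod 2) else 0) =
        if cs.simple j * x * cs.simple j = cs.simple i then 1 else 0 := by
      refine if_congr ?_ rfl rfl
      rw [simple_conj_eq_iff, simple_conj_eq_iff, hb']
    simp only [signedConj_mk, ci, cj, cij, Prod.mk.injEq]
    refine ⟨?_, by ring⟩
    calc _ = (cs.simple i * cs.simple j * cs.simple i) * x *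
          (cs.simple i * cs.simple j * cs.simple i) := by simp only [mul_assoc]
      _ = (cs.simple j * cs.simple i * cs.simple j) * x *
          (cs.simple j * cs.simple i * cs.simple j) := by rw [hb']
      _ = _ := by simp only [mul_assoc]

/-- The action of `W` on signed group elements. -/
noncomputable def signedAction (hM : M.IsSimplyLaced) : W →* Function.End (W × ZMod 2) :=
  cs.lift ⟨_, cs.isLiftable_signedConj hM⟩

/-- The reflection cocycle; for a reflection `t`, it is nonzero if and only if `t` is a right
inversion of `w`. -/
noncomputable def cocycle (hM : M.IsSimplyLaced) (w x : W) : ZMod 2 :=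
  (cs.signedAction hM w (x, 0)).2

variable (hM : M.IsSimplyLaced)

theorem signedAction_apply (w x : W) (e : ZMod 2) :
    cs.signedAction hM w (x, e) = (w * x * w⁻¹, e + cs.cocycle hM w x) := by
  have key : ∀ x e, cs.signedAction hM w (x, e) =
      (w * x * w⁻¹, e + (cs.signedAction hM w (x, 0)).2) := by
    induction w using cs.simple_induction_left with
    | one =>
      intro x e
      rw [map_one]
      change (x, e) = (1 * x * 1⁻¹, e + 0)
      simp
    | mul_simple_left w i ih =>
      intro x e
      have hs : ∀ p, cs.signedAction hM (cs.simple i * w) p =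
          cs.signedConj i (cs.signedAction hM w p) := fun p => by
        rw [map_mul]
        change cs.signedAction hM (cs.simple i) (cs.signedAction hM w p) = _
        exact congrFun (cs.lift_apply_simple (cs.isLiftable_signedConj hM) i) _
      rw [hs, hs, ih x e, ih x 0]
      simp only [signedConj, Prod.mk.injEq]
      exact ⟨by simp [mul_assoc], by ring⟩
  exact key x e

theorem cocycle_mul (v w x : W) :
    cs.cocycle hM (v * w) x = cs.cocycle hM w x + cs.cocycle hM v (w * x * w⁻¹) := by
  conv_lhs => rw [cocycle, map_mul]
  change (cs.signedAction hM v (cs.signedAction hM w (x, 0))).2 = _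
  rw [signedAction_apply, signedAction_apply, zero_add]

theorem cocycle_one (x : W) : cs.cocycle hM 1 x = 0 := by
  rw [cocycle, map_one]
  rfl

open Classical in
theorem cocycle_simple (i : B) (x : W) :
    cs.cocycle hM (cs.simple i) x = if x = cs.simple i then 1 else 0 := by
  have : cs.signedAction hM (cs.simple i) = cs.signedConj i :=
    cs.lift_apply_simple (cs.isLiftable_signedConj hM) i
  rw [cocycle, this, signedConj, zero_add]

theorem IsReflection.cocycle_self {t : W} (ht : cs.IsReflection t) : cs.cocycle hM t t = 1 := by
  obtain ⟨u, i, rfl⟩ := ht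
  have h := cs.cocycle_mul hM u u⁻¹ (u * cs.simple i * u⁻¹)
  rw [mul_inv_cancel, cocycle_one] at h
  rw [cocycle_mul, cocycle_mul, cocycle_simple]
  simp only [mul_assoc, inv_mul_cancel_left, inv_inv, inv_mul_cancel, mul_one, one_mul,
    simple_mul_simple_self, inv_simple, if_true] at h ⊢
  linear_combination -h

/-- Each letter contributes `1` exactly when its entry in the right inversion sequence is `t`, so
the cocycle counts occurrences of `t` modulo 2, independently of the word. This yields strong
exchange. -/
theorem mem_rightInvSeq_of_cocycle_ne_zero (ω : List B) {t : W}
    (h : cs.cocycle hM (cs.wordProd ω) t ≠ 0) : t ∈ cs.rightInvSeq ω := by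
  induction ω with
  | nil => simp [cocycle_one] at h
  | cons i ω ih =>
    rw [wordProd_cons, cocycle_mul, cocycle_simple] at h
    rw [rightInvSeq, List.mem_cons]
    by_cases hc : cs.wordProd ω * t * (cs.wordProd ω)⁻¹ = cs.simple i
    · left
      rw [← hc]; group
    · right
      rw [if_neg hc, add_zero] at h
      exact ih h

theorem length_mul_lt_of_cocycle_ne_zero {w t : W} (h : cs.cocycle hM w t ≠ 0) :
    cs.length (w * t) < cs.length w := by
  obtain ⟨ω, hω, rfl⟩ := cs.exists_isReduced w
  exact (cs.isRightInversion_of_mem_rightInvSeq hω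
    (cs.mem_rightInvSeq_of_cocycle_ne_zero hM ω h)).2

/-- Since the cocycle of `t` at `t` is `1`, exactly one of `w` and `w * t` has nonzero cocycle at
`t`, and that one is the longer. -/
theorem IsReflection.length_mul_lt_iff {w t : W} (ht : cs.IsReflection t) :
    cs.length (w * t) < cs.length w ↔ cs.cocycle hM w t ≠ 0 := by
  refine ⟨fun h h0 => ?_, cs.length_mul_lt_of_cocycle_ne_zero hM⟩
  have h1 : cs.cocycle hM (w * t) t ≠ 0 := by
    rw [cocycle_mul, ht.cocycle_self, mul_assoc, mul_inv_cancel, mul_one, h0, add_zero]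
    exact one_ne_zero
  have := cs.length_mul_lt_of_cocycle_ne_zero hM h1
  rw [mul_assoc, ht.mul_self, mul_one] at this
  omega

/-- Left multiplication by a generator changes the cocycle at `t` only if `w * t * w⁻¹` is that
generator, which is the excluded case. -/
theorem IsReflection.simple_mul_length_lt (hM : M.IsSimplyLaced) {i : B} {w t : W}
    (ht : cs.IsReflection t) (h : cs.length w < cs.length (w * t)) (hne : w * t ≠ cs.simple i * w) :
    cs.length (cs.simple i * w) < cs.length (cs.simple i * (w * t)) := by
  have h1 : cs.cocycle hM w t = 0 := by
    by_contra h0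
    have := (ht.length_mul_lt_iff cs hM).2 h0
    omega
  have h2 : cs.cocycle hM (cs.simple i * w) t = 0 := by
    rw [cocycle_mul, h1, cocycle_simple, if_neg, add_zero]
    intro h
    exact hne (by rw [← h]; group)
  have h3 : ¬ cs.length (cs.simple i * w * t) < cs.length (cs.simple i * w) := by
    rw [ht.length_mul_lt_iff cs hM]
    simpa using h2
  have h4 := ht.length_mul_left_ne (cs.simple i * w)
  rw [← mul_assoc]
  omega

end CoxeterSystem

namespace CoxeterSystem

variable {B : Type*} {M : CoxeterMatrix B} {W : Type*} [Group W] (cs : CoxeterSystem M W)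

/-! ### Lifting and gradedness of the Bruhat order -/

variable {cs} in
theorem BruhatLE.trans {x y z : W} (h : cs.BruhatLE x y) (h' : cs.BruhatLE y z) :
    cs.BruhatLE x z := Relation.ReflTransGen.trans h h'

theorem bruhatLE_refl (x : W) : cs.BruhatLE x x := Relation.ReflTransGen.refl

variable {cs} in
theorem BruhatLE.eq_of_length_le {x y : W} (h : cs.BruhatLE x y)
    (hl : cs.length y ≤ cs.length x) : x = y :=
  (h.eq_or_length_lt cs).resolve_right (by omega)

theorem bruhatLE_simple_mul {i : B} {x : W} (h : ¬ cs.IsLeftDescent x i) :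
    cs.BruhatLE x (cs.simple i * x) := by
  rw [not_isLeftDescent_iff] at h
  refine Relation.ReflTransGen.single ⟨x⁻¹ * cs.simple i * x⁻¹⁻¹, ⟨x⁻¹, i, rfl⟩, ?_, by omega⟩
  group

theorem simple_mul_bruhatLE {i : B} {x : W} (h : cs.IsLeftDescent x i) :
    cs.BruhatLE (cs.simple i * x) x := by
  simpa using cs.bruhatLE_simple_mul (cs.isLeftDescent_iff_not_isLeftDescent_mul.1 h)

-- Multiply a chain from `x` to `y` by `s_i` on the left: every step still goes up, except a step
-- from `u` to `s_i u`. The first such step already places `s_i x` below `y`.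
variable {cs} in
theorem BruhatLE.simple_mul_le_or (hM : M.IsSimplyLaced) (i : B) {x y : W}
    (h : cs.BruhatLE x y) :
    cs.BruhatLE (cs.simple i * x) y ∨ cs.BruhatLE (cs.simple i * x) (cs.simple i * y) := by
  induction h using Relation.ReflTransGen.head_induction_on with
  | refl => exact Or.inr (cs.bruhatLE_refl _)
  | head hxz hzy ih =>
    obtain ⟨t, ht, rfl, hl⟩ := hxz
    rename_i x
    by_cases he : x * t = cs.simple i * x
    · rw [← he]; exact Or.inl hzy
    · have hstep : cs.BruhatLE (cs.simple i * x) (cs.simple i * (x * t)) :=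
        Relation.ReflTransGen.single
          ⟨t, ht, (mul_assoc _ _ _).symm, ht.simple_mul_length_lt cs hM hl he⟩
      exact ih.imp hstep.trans hstep.trans

variable {cs} in
theorem BruhatLE.le_simple_mul_or (hM : M.IsSimplyLaced) (i : B) {x y : W}
    (h : cs.BruhatLE x y) :
    cs.BruhatLE x (cs.simple i * y) ∨ cs.BruhatLE (cs.simple i * x) (cs.simple i * y) := by
  induction h with
  | refl => exact Or.inr (cs.bruhatLE_refl _)
  | tail hxz hzy ih =>
    obtain ⟨t, ht, rfl, hl⟩ := hzy
    rename_i z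
    by_cases he : z * t = cs.simple i * z
    · rw [he, simple_mul_simple_cancel_left]; exact Or.inl hxz
    · have hstep : cs.BruhatLE (cs.simple i * z) (cs.simple i * (z * t)) :=
        Relation.ReflTransGen.single
          ⟨t, ht, (mul_assoc _ _ _).symm, ht.simple_mul_length_lt cs hM hl he⟩
      exact ih.imp (fun h => h.trans hstep) fun h => h.trans hstep

variable {cs} in
theorem BruhatLE.le_simple_mul (hM : M.IsSimplyLaced) {i : B} {x y : W}
    (h : cs.BruhatLE x y) (hx : ¬ cs.IsLeftDescent x i) : cs.BruhatLE x (cs.simple i * y) :=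
  (h.le_simple_mul_or hM i).elim id (cs.bruhatLE_simple_mul hx).trans

variable {cs} in
theorem BruhatLE.simple_mul_le (hM : M.IsSimplyLaced) {i : B} {x y : W}
    (h : cs.BruhatLE x y) (hy : cs.IsLeftDescent y i) : cs.BruhatLE (cs.simple i * x) y :=
  (h.simple_mul_le_or hM i).elim id fun h => h.trans (cs.simple_mul_bruhatLE hy)

variable {cs} in
theorem BruhatLE.simple_mul_le_simple_mul (hM : M.IsSimplyLaced) {i : B} {x y : W}
    (h : cs.BruhatLE x y) (hx : cs.IsLeftDescent x i) :
    cs.BruhatLE (cs.simple i * x) (cs.simple i * y) :=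
  ((cs.simple_mul_bruhatLE hx).trans h).le_simple_mul hM
    (cs.isLeftDescent_iff_not_isLeftDescent_mul.1 hx)

variable {cs} in
theorem BruhatLE.inv {x y : W} (h : cs.BruhatLE x y) : cs.BruhatLE x⁻¹ y⁻¹ := by
  induction h with
  | refl => exact cs.bruhatLE_refl _
  | tail _ hzy ih =>
    obtain ⟨t, ht, rfl, hl⟩ := hzy
    rename_i z _
    refine ih.trans (Relation.ReflTransGen.single ⟨_, ht.conj z, ?_, by rwa [length_inv, length_inv]⟩)
    rw [mul_inv_rev, ht.inv]; group

theorem bruhatLE_inv_iff {x y : W} : cs.BruhatLE x⁻¹ y⁻¹ ↔ cs.BruhatLE x y :=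
  ⟨fun h => by simpa using h.inv, fun h => h.inv⟩

variable {cs} in
theorem BruhatLE.mul_simple_le (hM : M.IsSimplyLaced) {i : B} {x y : W}
    (h : cs.BruhatLE x y) (hy : cs.IsRightDescent y i) : cs.BruhatLE (x * cs.simple i) y := by
  have := h.inv.simple_mul_le hM (cs.isLeftDescent_inv_iff.2 hy)
  rw [← bruhatLE_inv_iff]
  simpa using this

theorem bruhatLE_mul_simple {i : B} {x : W} (h : ¬ cs.IsRightDescent x i) :
    cs.BruhatLE x (x * cs.simple i) := by
  rw [← bruhatLE_inv_iff]
  simpa using cs.bruhatLE_simple_mul (x := x⁻¹) (by rwa [isLeftDescent_inv_iff])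

theorem one_bruhatLE (x : W) : cs.BruhatLE 1 x := by
  induction hn : cs.length x using Nat.strong_induction_on generalizing x with
  | _ n ih =>
    by_cases hx : x = 1
    · subst hx; exact cs.bruhatLE_refl 1
    · obtain ⟨i, hi⟩ := cs.exists_leftDescent_of_ne_one hx
      exact (ih _ (hn ▸ hi) _ rfl).trans (cs.simple_mul_bruhatLE hi)

theorem IsLeftDescent.simple_le {cs : CoxeterSystem M W} (hM : M.IsSimplyLaced) {i : B} {x : W}
    (h : cs.IsLeftDescent x i) : cs.BruhatLE (cs.simple i) x := by
  simpa using (cs.one_bruhatLE x).simple_mul_le hM h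

-- Gradedness: saturated chains change length by one. The induction strips a left descent `i` of `y`
-- and lifts the coatom found below `s_i y` back to `y`.
variable {cs} in
theorem BruhatLE.exists_le_length_succ (hM : M.IsSimplyLaced) {x y : W} (h : cs.BruhatLE x y)
    (hne : x ≠ y) : ∃ z, cs.BruhatLE x z ∧ cs.BruhatLE z y ∧ cs.length y = cs.length z + 1 := by
  induction hn : cs.length y using Nat.strong_induction_on generalizing x y with
  | _ n ih =>
    have hlt := (h.eq_or_length_lt cs).resolve_left hne
    obtain ⟨i, hi⟩ := cs.exists_leftDescent_of_ne_one (w := y) (by rintro rfl; simp at hlt)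
    have hi' := cs.isLeftDescent_iff.1 hi
    have hy := cs.simple_mul_bruhatLE hi
    by_cases hx : cs.IsLeftDescent x i
    · obtain ⟨z, h1, h2, h3⟩ := ih _ (hn ▸ hi) (h.simple_mul_le_simple_mul hM hx)
        (fun h => hne (mul_left_cancel h)) rfl
      by_cases hz : cs.IsLeftDescent z i
      · have := h1.simple_mul_le hM hz
        rw [simple_mul_simple_cancel_left] at this
        exact ⟨_, this.trans h2, hy, by omega⟩
      · refine ⟨cs.simple i * z, ?_, (h2.trans hy).simple_mul_le hM hi, ?_⟩
        · have := (h1.trans (cs.bruhatLE_simple_mul hz)).simple_mul_le (i := i) hM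
            (by rw [isLeftDescent_iff_not_isLeftDescent_mul]; simpa using hz)
          rwa [simple_mul_simple_cancel_left] at this
        · have := cs.not_isLeftDescent_iff.1 hz
          omega
    · exact ⟨_, h.le_simple_mul hM hx, hy, by omega⟩

theorem covBy_iff (hM : M.IsSimplyLaced) {x y : W} :
    letI := cs.bruhatOrder
    x ⋖ y ↔ cs.BruhatLE x y ∧ cs.length y = cs.length x + 1 := by
  let := cs.bruhatOrder
  constructor
  · intro h
    obtain ⟨z, h1, h2, h3⟩ := BruhatLE.exists_le_length_succ hM (cs := cs) h.le h.lt.ne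
    have hz : z < y := lt_of_le_of_ne h2 (by rintro rfl; omega)
    obtain rfl : x = z := by
      by_contra hxz
      exact h.2 (lt_of_le_of_ne h1 hxz) hz
    exact ⟨h2, h3⟩
  · rintro ⟨h, hl⟩
    refine ⟨lt_of_le_of_ne h (by rintro rfl; omega), fun z h1 h2 => ?_⟩
    have q1 := (BruhatLE.eq_or_length_lt cs h1.le).resolve_left h1.ne
    have q2 := (BruhatLE.eq_or_length_lt cs h2.le).resolve_left h2.ne
    omega

theorem length_of_covBy (hM : M.IsSimplyLaced) (x y : W) :
    letI := cs.bruhatOrder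
    x ⋖ y → cs.length y = cs.length x + 1 := fun h => ((cs.covBy_iff hM).1 h).2

theorem exists_le_covBy (hM : M.IsSimplyLaced) (x y : W) :
    letI := cs.bruhatOrder
    x < y → ∃ z, x ≤ z ∧ z ⋖ y := by
  let := cs.bruhatOrder
  intro h
  obtain ⟨z, h1, h2, h3⟩ := BruhatLE.exists_le_length_succ hM (cs := cs) h.le h.ne
  exact ⟨z, h1, (cs.covBy_iff hM).2 ⟨h2, h3⟩⟩

theorem covBy_inv_iff (hM : M.IsSimplyLaced) {x y : W} :
    letI := cs.bruhatOrder
    x⁻¹ ⋖ y⁻¹ ↔ x ⋖ y := by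
  let := cs.bruhatOrder
  rw [cs.covBy_iff hM, cs.covBy_iff hM, bruhatLE_inv_iff, length_inv, length_inv]

theorem covBy_simple_mul_iff (hM : M.IsSimplyLaced) {i : B} {x : W} :
    letI := cs.bruhatOrder
    x ⋖ cs.simple i * x ↔ ¬ cs.IsLeftDescent x i := by
  let := cs.bruhatOrder
  rw [cs.covBy_iff hM, not_isLeftDescent_iff]
  exact ⟨And.right, fun h => ⟨cs.bruhatLE_simple_mul (cs.not_isLeftDescent_iff.2 h), h⟩⟩

theorem isMatchingOn_simple_mul (hM : M.IsSimplyLaced) (i : B) :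
    letI := cs.bruhatOrder
    IsMatchingOn Set.univ (fun x => cs.simple i * x) := by
  let := cs.bruhatOrder
  refine ⟨isLowerSet_univ, fun _ => Set.mem_univ _, fun _ => cs.simple_mul_simple_cancel_left i,
    fun {x} _ => ?_, fun {x} _ hx y => ?_⟩
  · rw [cs.covBy_simple_mul_iff hM, or_iff_not_imp_left, not_not]
    intro h
    exact (cs.covBy_iff hM).2 ⟨cs.simple_mul_bruhatLE h, (cs.isLeftDescent_iff.1 h).symm⟩
  · have hl := cs.length_of_covBy hM _ _ hx
    simp only [cs.covBy_simple_mul_iff hM] at hx ⊢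
    constructor
    · intro h
      obtain ⟨h1, h2⟩ := (cs.covBy_iff hM).1 h
      -- By lifting, a coatom `y` of `s_i x` without left descent `i` lies below `x`, hence equals
      -- it; any other is `s_i v` with `v = s_i y` covered by `x`.
      by_cases hy : cs.IsLeftDescent y i
      · have h3 := h1.simple_mul_le_simple_mul hM hy
        have h4 := cs.isLeftDescent_iff.1 hy
        rw [simple_mul_simple_cancel_left] at h3
        exact Or.inr ⟨cs.simple i * y, (cs.covBy_iff hM).2 ⟨h3, by omega⟩,
          cs.isLeftDescent_iff_not_isLeftDescent_mul.1 hy, by simp⟩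
      · have h3 := h1.le_simple_mul hM hy
        rw [simple_mul_simple_cancel_left] at h3
        exact Or.inl (h3.eq_of_length_le (by omega))
    · rintro (rfl | ⟨v, hv, hv', rfl⟩)
      · exact (cs.covBy_simple_mul_iff hM).2 hx
      · obtain ⟨h1, h2⟩ := (cs.covBy_iff hM).1 hv
        have h3 := cs.not_isLeftDescent_iff.1 hv'
        refine (cs.covBy_iff hM).2 ⟨?_, by omega⟩
        refine (h1.trans (cs.bruhatLE_simple_mul hx)).simple_mul_le hM ?_
        rw [isLeftDescent_iff_not_isLeftDescent_mul]
        simpa using hx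

theorem isMatchingOn_mul_simple (hM : M.IsSimplyLaced) (i : B) :
    letI := cs.bruhatOrder
    IsMatchingOn Set.univ (fun x => x * cs.simple i) := by
  let := cs.bruhatOrder
  have h := cs.isMatchingOn_simple_mul hM i
  have hinv : ∀ x, cs.simple i * x⁻¹ = (x * cs.simple i)⁻¹ := fun x => by simp
  refine ⟨isLowerSet_univ, fun _ => Set.mem_univ _, fun _ => cs.simple_mul_simple_cancel_right i,
    fun {x} _ => ?_, fun {x} _ hx y => ?_⟩
  · have := h.covBy_or (x := x⁻¹) (Set.mem_univ _)
    simpa only [hinv, cs.covBy_inv_iff hM] using this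
  · have := h.covBy_iff (x := x⁻¹) (Set.mem_univ _)
      (by simpa only [hinv, cs.covBy_inv_iff hM] using hx) y⁻¹
    simp only [hinv, cs.covBy_inv_iff hM, inv_inj] at this
    rw [this]
    refine or_congr_right ((Equiv.inv W).exists_congr fun v => ?_).symm
    simp only [Equiv.inv_apply, hinv, cs.covBy_inv_iff hM, inv_inj]

/-! ### Elements are determined by their coatoms -/

/-- The coatom `s_i a` lies below `b`; as `i` is a descent of `b`, lifting gives `a ≤ b`, and the
lengths agree. -/
theorem eq_of_coatoms_of_isLeftDescent (hM : M.IsSimplyLaced) {a b : W}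
    (h : ∀ z, cs.BruhatLE z a ∧ cs.length a = cs.length z + 1 →
      cs.BruhatLE z b ∧ cs.length b = cs.length z + 1) {i : B} (ha : cs.IsLeftDescent a i)
    (hb : cs.IsLeftDescent b i) : a = b := by
  obtain ⟨h1, h2⟩ := h _ ⟨cs.simple_mul_bruhatLE ha, (cs.isLeftDescent_iff.1 ha).symm⟩
  have h3 := h1.simple_mul_le hM hb
  have h4 := cs.isLeftDescent_iff.1 ha
  rw [simple_mul_simple_cancel_left] at h3
  exact h3.eq_of_length_le (by omega)

theorem eq_of_coatoms_of_isRightDescent (hM : M.IsSimplyLaced) {a b : W}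
    (h : ∀ z, cs.BruhatLE z a ∧ cs.length a = cs.length z + 1 →
      cs.BruhatLE z b ∧ cs.length b = cs.length z + 1) {i : B} (ha : cs.IsRightDescent a i)
    (hb : cs.IsRightDescent b i) : a = b := by
  refine inv_injective (cs.eq_of_coatoms_of_isLeftDescent hM (i := i) (fun z hz => ?_)
    (cs.isLeftDescent_inv_iff.2 ha) (cs.isLeftDescent_inv_iff.2 hb))
  have := h z⁻¹ (by rw [← bruhatLE_inv_iff]; simpa using hz)
  rw [← bruhatLE_inv_iff] at this
  simpa using this

/-- In a simply laced Coxeter group, an element of length at least three is determined by its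
coatoms in the Bruhat order. -/
theorem eq_of_coatoms (hM : M.IsSimplyLaced) {a b : W} (hla : 3 ≤ cs.length a)
    (hlb : 3 ≤ cs.length b)
    (h : ∀ z, cs.BruhatLE z a ∧ cs.length a = cs.length z + 1 ↔
      cs.BruhatLE z b ∧ cs.length b = cs.length z + 1) : a = b := by
  by_contra hne
  have hleft : ∀ {i}, cs.IsLeftDescent a i → ¬ cs.IsLeftDescent b i := fun ha hb =>
    hne (cs.eq_of_coatoms_of_isLeftDescent hM (fun z => (h z).1) ha hb)
  have hright : ∀ {i}, cs.IsRightDescent a i → ¬ cs.IsRightDescent b i := fun ha hb =>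
    hne (cs.eq_of_coatoms_of_isRightDescent hM (fun z => (h z).1) ha hb)
  obtain ⟨r, hr⟩ := cs.exists_leftDescent_of_ne_one (w := a) (by rintro rfl; simp at hla)
  obtain ⟨t, ht⟩ := cs.exists_leftDescent_of_ne_one (w := b) (by rintro rfl; simp at hlb)
  have hrt : cs.simple r ≠ cs.simple t := fun he => hleft hr (by
    unfold IsLeftDescent at ht ⊢; rwa [he])
  have lr := cs.isLeftDescent_iff.1 hr
  have lt := cs.isLeftDescent_iff.1 ht
  have hu := (h _).1 ⟨cs.simple_mul_bruhatLE hr, lr.symm⟩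
  have hv := (h _).2 ⟨cs.simple_mul_bruhatLE ht, lt.symm⟩
  have hab : cs.length a = cs.length b := by omega
  -- If the two coatoms coincide, they have length at least two, and any right descent of them is a
  -- right descent of both `a` and `b`.
  by_cases huv : cs.simple r * a = cs.simple t * b
  · obtain ⟨p, hp⟩ := cs.exists_rightDescent_of_ne_one (w := cs.simple r * a) (by
      intro he; rw [he] at lr; simp at lr; omega)
    have hp' := cs.isRightDescent_iff.1 hp
    refine hright (i := p) ?_ ?_
    · have := cs.length_simple_mul (cs.simple r * a * cs.simple p) r
      rw [← mul_assoc, simple_mul_simple_cancel_left] at this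
      unfold IsRightDescent; omega
    · have := cs.length_simple_mul (cs.simple t * b * cs.simple p) t
      rw [← mul_assoc, simple_mul_simple_cancel_left, ← huv] at this
      unfold IsRightDescent; omega
  -- coatoms have `t`, resp. `r`, as a left descent, with one exception
  have ct : ∀ z, cs.BruhatLE z b → cs.length b = cs.length z + 1 → z ≠ cs.simple t * b →
      cs.IsLeftDescent z t := by
    intro z hz hl hzt
    by_contra hd
    exact hzt ((hz.le_simple_mul hM hd).eq_of_length_le (by omega))
  have cr : ∀ z, cs.BruhatLE z a → cs.length a = cs.length z + 1 → z ≠ cs.simple r * a →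
      cs.IsLeftDescent z r := by
    intro z hz hl hzt
    by_contra hd
    exact hzt ((hz.le_simple_mul hM hd).eq_of_length_le (by omega))
  have hut := ct _ hu.1 hu.2 huv
  have hvr := cr _ hv.1 hv.2 (Ne.symm huv)
  have lut := cs.isLeftDescent_iff.1 hut
  have lvr := cs.isLeftDescent_iff.1 hvr
  rcases hM r t (fun he => hrt (he ▸ rfl)) with hm | hm
  · have hc := cs.simple_comm_of_eq_two hm
    refine hleft (i := t) ?_ ht
    have := cs.length_simple_mul (cs.simple t * (cs.simple r * a)) r
    rw [← mul_assoc, ← mul_assoc, hc, simple_mul_simple_cancel_right] at this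
    unfold IsLeftDescent; omega
  · have hb := cs.simple_braid_of_eq_three hm
    obtain ⟨x, hx⟩ : ∃ x, x = cs.simple t * (cs.simple r * a) := ⟨_, rfl⟩
    obtain ⟨y, hy⟩ : ∃ y, y = cs.simple r * (cs.simple t * b) := ⟨_, rfl⟩
    have hax : a = cs.simple r * (cs.simple t * x) := by rw [hx]; simp
    have hby : b = cs.simple t * (cs.simple r * y) := by rw [hy]; simp
    rw [← hx] at lut
    rw [← hy] at lvr
    have hxr : ¬ cs.IsLeftDescent x r := by
      intro hd
      have hd' := cs.isLeftDescent_iff.1 hd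
      refine hleft (i := t) ?_ ht
      have e : cs.simple t * a = cs.simple r * (cs.simple t * (cs.simple r * x)) := by
        calc cs.simple t * a = cs.simple t * (cs.simple r * (cs.simple t * cs.simple r)) *
              (cs.simple r * x) := by rw [hax]; simp [mul_assoc]
          _ = cs.simple t * (cs.simple t * (cs.simple r * cs.simple t)) *
              (cs.simple r * x) := by rw [hb]
          _ = _ := by simp [mul_assoc]
      have q1 := cs.length_simple_mul (cs.simple r * x) t
      have q2 := cs.length_simple_mul (cs.simple t * (cs.simple r * x)) r
      rw [← e] at q2
      unfold IsLeftDescent; omega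
    have hxr' := cs.not_isLeftDescent_iff.1 hxr
    have hxa : cs.BruhatLE x a := by
      rw [hx]; exact (cs.simple_mul_bruhatLE hut).trans (cs.simple_mul_bruhatLE hr)
    have hrx := (h _).1 ⟨hxa.simple_mul_le hM hr, by omega⟩
    -- Otherwise the coatom `r x` of `b` differs from `t b = r y`, so it has left descent `t`; then
    -- `t x ≤ r x` with equal lengths, and `r = t`.
    have hxy : x = y := by
      by_contra hxy
      have hd := ct _ hrx.1 hrx.2 (by
        intro he; apply hxy; rw [hy, ← he, simple_mul_simple_cancel_left])
      have h1 := (cs.bruhatLE_simple_mul hxr).simple_mul_le hM hd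
      have h2 : cs.length (cs.simple t * x) = cs.length x + 1 := by
        rw [hx, simple_mul_simple_cancel_left, ← hx]; omega
      exact hrt (mul_right_cancel (h1.eq_of_length_le (by omega))).symm
    obtain ⟨p, hp⟩ := cs.exists_rightDescent_of_ne_one (w := x) (by
      rintro he; rw [he] at lut; simp at lut; omega)
    have hp' := cs.isRightDescent_iff.1 hp
    -- Now `a = r t x` and `b = t r x`. The hypothesis of length at least three makes `x ≠ 1`, and a
    -- right descent `p` of `x` is one of both.
    have key : ∀ i j, cs.length (cs.simple i * (cs.simple j * x) * cs.simple p) ≤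
        cs.length x + 1 := fun i j => by
      rw [mul_assoc, mul_assoc]
      have q1 := cs.length_simple_mul (x * cs.simple p) j
      have q2 := cs.length_simple_mul (cs.simple j * (x * cs.simple p)) i
      omega
    refine hright (i := p) ?_ ?_
    · have := key r t
      rw [← hax] at this
      unfold IsRightDescent; omega
    · have := key t r
      rw [hxy, ← hby, ← hxy] at this
      unfold IsRightDescent; omega

end CoxeterSystem

namespace CoxeterSystem

variable {B : Type*} {M : CoxeterMatrix B} {W : Type*} [Group W] (cs : CoxeterSystem M W)

/-! ### Injectivity of the generators -/

open Classical in
/-- The action of a generator on labellings of the Coxeter graph (the dual of the geometric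
representation). -/
noncomputable def labelAction (M : CoxeterMatrix B) (i : B) : Function.End (B → ℤ) := fun f j =>
  if j = i then - f i else if M i j = 3 then f j + f i else f j

open Classical in
theorem labelAction_apply (i : B) (f : B → ℤ) (j : B) : labelAction M i f j =
    if j = i then - f i else if M i j = 3 then f j + f i else f j := rfl

theorem isLiftable_labelAction (hM : M.IsSimplyLaced) : M.IsLiftable (labelAction M) := by
  have ext : ∀ a b : Function.End (B → ℤ), (∀ f k, a f k = b f k) → a = b :=
    fun a b h => funext fun f => funext fun k => h f k
  refine hM.isLiftable _ (fun i => ext _ _ fun f k => ?_) (fun i j h => ext _ _ fun f k => ?_)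
    (fun i j h => ext _ _ fun f k => ?_)
  · change labelAction M i (labelAction M i f) k = f k
    simp only [labelAction_apply]
    by_cases hk : k = i
    · simp [hk]
    · by_cases h3 : M i k = 3 <;> simp [hk, h3]
  · have hij : i ≠ j := by rintro rfl; simp at h
    have h' : M j i = 2 := by rw [M.symmetric]; exact h
    change labelAction M i (labelAction M j f) k = labelAction M j (labelAction M i f) k
    simp only [labelAction_apply]
    by_cases hk : k = i
    · subst hk; simp [hij, h']
    by_cases hk' : k = j
    · subst hk'; simp [hk, h]
    by_cases h3 : M i k = 3 <;> by_cases h4 : M j k = 3 <;>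
      simp [hk, hk', h3, h4, h, h', hij, hij.symm]
    ring
  · have hij : i ≠ j := by rintro rfl; simp at h
    have h' : M j i = 3 := by rw [M.symmetric]; exact h
    change labelAction M i (labelAction M j (labelAction M i f)) k =
      labelAction M j (labelAction M i (labelAction M j f)) k
    simp only [labelAction_apply]
    by_cases hk : k = i
    · subst hk; simp [hij, hij.symm, h, h']
    by_cases hk' : k = j
    · subst hk'; simp [hk, hij, h, h']
    by_cases h3 : M i k = 3 <;> by_cases h4 : M j k = 3 <;> simp [hk, hk', h3, h4, h, h', hij,
      hij.symm] <;> ring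

/-- The indicator of `i` is sent by `s_i` to a labelling with value `-1` at `i`, whereas any other
generator leaves the value `1` there. -/
theorem simple_injective (hM : M.IsSimplyLaced) : Function.Injective cs.simple := by
  classical
  intro i j hij
  by_contra hne
  have h1 := cs.lift_apply_simple (isLiftable_labelAction hM) i
  have h2 := cs.lift_apply_simple (isLiftable_labelAction hM) j
  rw [hij, h2] at h1
  have h3 := congrFun (congrFun h1 (Pi.single i 1)) i
  simp only [labelAction_apply] at h3
  simp [hne, Ne.symm hne] at h3

/-! ### Words in two and three generators -/

theorem length_simple_mul_simple {i j : B} (h : cs.simple i ≠ cs.simple j) :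
    cs.length (cs.simple i * cs.simple j) = 2 := by
  have h1 := cs.length_mul_simple (cs.simple i) j
  rw [length_simple] at h1
  refine h1.resolve_right fun h2 => h ?_
  rw [← cs.inv_simple j]
  exact mul_eq_one_iff_eq_inv.1 (cs.length_eq_zero_iff.1 (by omega))

variable {cs} in
theorem BruhatLE.simple_eq_simple {i j : B} (h : cs.BruhatLE (cs.simple i) (cs.simple j)) :
    cs.simple i = cs.simple j := h.eq_of_length_le (by simp)

theorem isLeftDescent_simple_iff {i j : B} :
    cs.IsLeftDescent (cs.simple j) i ↔ cs.simple i = cs.simple j := by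
  constructor
  · intro h
    by_contra hne
    have := cs.length_simple_mul_simple hne
    simp [IsLeftDescent, this] at h
  · intro h
    simp [IsLeftDescent, h]

theorem length_simple_mul_simple_mul_simple (hM : M.IsSimplyLaced) {i j : B}
    (h : cs.simple i * cs.simple j ≠ cs.simple j * cs.simple i) :
    cs.length (cs.simple i * (cs.simple j * cs.simple i)) = 3 := by
  have hne : cs.simple i ≠ cs.simple j := fun he => h (by rw [he])
  have h1 := cs.length_simple_mul_simple hne
  have h2 := cs.length_simple_mul_simple hne.symm
  have h3 := cs.length_simple_mul (cs.simple j * cs.simple i) i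
  rw [h2] at h3
  refine h3.resolve_right fun h4 => h ?_
  have h5 : cs.BruhatLE (cs.simple j) (cs.simple j * cs.simple i) := by
    apply bruhatLE_mul_simple
    simp [IsRightDescent, h2]
  refine (h5.simple_mul_le hM (i := i) ?_).eq_of_length_le (by omega)
  unfold IsLeftDescent
  omega

theorem mul_eq_three_of_not_comm (hM : M.IsSimplyLaced) {i j : B}
    (h : cs.simple i * cs.simple j ≠ cs.simple j * cs.simple i) : M i j = 3 :=
  (hM i j (fun he => h (by rw [he]))).resolve_left fun h2 => h (cs.simple_comm_of_eq_two h2)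

theorem simple_eq_or_of_bruhatLE (hM : M.IsSimplyLaced) {a i j : B}
    (h : cs.BruhatLE (cs.simple a) (cs.simple i * (cs.simple j * cs.simple i))) :
    cs.simple a = cs.simple i ∨ cs.simple a = cs.simple j := by
  by_contra! hne
  have h1 : ∀ {b}, cs.simple a ≠ cs.simple b → ¬ cs.IsLeftDescent (cs.simple a) b := fun hb hd =>
    hb (cs.isLeftDescent_simple_iff.1 hd).symm
  have h2 := (h.le_simple_mul hM (h1 hne.1)).le_simple_mul hM (h1 hne.2)
  simp only [simple_mul_simple_cancel_left] at h2
  exact hne.1 h2.simple_eq_simple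

/-- If `s` does not commute with `l` and `r`, then `lsr`, `sls` and `srs` have no common upper
cover. -/
theorem not_exists_common_cover (hM : M.IsSimplyLaced) {s l r : B}
    (hl : cs.simple s * cs.simple l ≠ cs.simple l * cs.simple s)
    (hr : cs.simple s * cs.simple r ≠ cs.simple r * cs.simple s)
    (hlr : cs.simple l ≠ cs.simple r) {y : W} (hy : cs.length y = 4)
    (h1 : cs.BruhatLE (cs.simple l * (cs.simple s * cs.simple r)) y)
    (h2 : cs.BruhatLE (cs.simple s * (cs.simple l * cs.simple s)) y)
    (h3 : cs.BruhatLE (cs.simple s * (cs.simple r * cs.simple s)) y) : False := by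
  have hsl : cs.simple s ≠ cs.simple l := fun he => hl (by rw [he])
  have hsr : cs.simple s ≠ cs.simple r := fun he => hr (by rw [he])
  have n1 := cs.length_simple_mul_simple_mul_simple hM hl
  have n2 := cs.length_simple_mul_simple_mul_simple hM hr
  have m1 := cs.length_simple_mul_simple hsr
  have m2 := cs.length_simple_mul_simple hsr.symm
  have m3 := cs.length_simple_mul_simple hsl
  have bl := cs.simple_braid_of_eq_three (cs.mul_eq_three_of_not_comm hM hl)
  have br := cs.simple_braid_of_eq_three (cs.mul_eq_three_of_not_comm hM hr)
  have el : ¬ cs.BruhatLE (cs.simple l) (cs.simple s * (cs.simple r * cs.simple s)) := fun h =>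
    (cs.simple_eq_or_of_bruhatLE hM h).elim (fun h => hsl h.symm) hlr
  have er : ¬ cs.BruhatLE (cs.simple r) (cs.simple s * (cs.simple l * cs.simple s)) := fun h =>
    (cs.simple_eq_or_of_bruhatLE hM h).elim (fun h => hsr h.symm) hlr.symm
  have le1 : cs.BruhatLE (cs.simple s * cs.simple r)
      (cs.simple s * (cs.simple r * cs.simple s)) := by
    rw [← mul_assoc]
    apply bruhatLE_mul_simple
    unfold IsRightDescent
    rw [mul_assoc]
    omega
  have le2 : cs.BruhatLE (cs.simple r * cs.simple s)
      (cs.simple s * (cs.simple r * cs.simple s)) := by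
    apply bruhatLE_simple_mul
    unfold IsLeftDescent
    omega
  have d1 : ¬ cs.IsLeftDescent (cs.simple s * cs.simple r) l := fun h =>
    el ((h.simple_le hM).trans le1)
  have d2 : ¬ cs.IsLeftDescent (cs.simple r * cs.simple s) l := fun h =>
    el ((h.simple_le hM).trans le2)
  have d3 : ¬ cs.IsLeftDescent (cs.simple s * (cs.simple r * cs.simple s)) l := fun h =>
    el (h.simple_le hM)
  have d4 : ¬ cs.IsLeftDescent (cs.simple s * (cs.simple l * cs.simple s)) r := fun h =>
    er (h.simple_le hM)
  have nx : cs.length (cs.simple l * (cs.simple s * cs.simple r)) = 3 := by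
    rw [cs.not_isLeftDescent_iff.1 d1, m1]
  have lx : cs.IsLeftDescent (cs.simple l * (cs.simple s * cs.simple r)) l := by
    unfold IsLeftDescent
    rw [simple_mul_simple_cancel_left]; omega
  have lex := cs.bruhatLE_simple_mul d1
  have d5 : ¬ cs.IsLeftDescent (cs.simple l * (cs.simple s * cs.simple r)) s := by
    intro h
    have q := ((lx.simple_le hM).simple_mul_le hM h).simple_mul_le hM lx
    have := q.eq_of_length_le (by rw [← bl]; omega)
    exact hlr (mul_left_cancel (mul_left_cancel this))
  have d6 : ¬ cs.IsLeftDescent (cs.simple l * (cs.simple s * cs.simple r)) r := by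
    intro h
    have := (lex.simple_mul_le hM h).eq_of_length_le (by rw [← br]; omega)
    exact hlr (mul_right_cancel this).symm
  obtain ⟨a, ha⟩ := cs.exists_leftDescent_of_ne_one (w := y) (by rintro rfl; simp at hy)
  have ny := cs.isLeftDescent_iff.1 ha
  -- A left descent `a` of `y` that is a descent of neither `sls` nor `srs` would force both to
  -- equal `a y`.
  have hcases : cs.simple a = cs.simple s ∨ cs.simple a = cs.simple l ∨
      cs.simple a = cs.simple r := by
    by_cases c1 : cs.IsLeftDescent (cs.simple s * (cs.simple l * cs.simple s)) a
    · have := cs.simple_eq_or_of_bruhatLE hM (c1.simple_le hM); tauto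
    by_cases c2 : cs.IsLeftDescent (cs.simple s * (cs.simple r * cs.simple s)) a
    · have := cs.simple_eq_or_of_bruhatLE hM (c2.simple_le hM); tauto
    have q1 := (h2.le_simple_mul hM c1).eq_of_length_le (by omega)
    have q2 := (h3.le_simple_mul hM c2).eq_of_length_le (by omega)
    exact absurd (mul_right_cancel (mul_left_cancel (q1.trans q2.symm))) hlr
  have hdesc : ∀ b, cs.simple a = cs.simple b → cs.IsLeftDescent y b := fun b hb => by
    unfold IsLeftDescent at ha ⊢; rwa [← hb]
  -- Descent `s`: `lsr = sy`, so `rs ≤ lsr` and then `rs ≤ sr`. Descent `l`: `srs = ly`, so `sl ≤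
  -- srs`. Descent `r`: `lsr = ry = sls`. Each is impossible.
  rcases hcases with he | he | he <;> have hd := hdesc _ he <;> have nd := cs.isLeftDescent_iff.1 hd
  · have q1 := (h1.le_simple_mul hM d5).eq_of_length_le (by omega)
    have q2 := h3.simple_mul_le_simple_mul hM (i := s) (by
      unfold IsLeftDescent; rw [simple_mul_simple_cancel_left]; omega)
    rw [simple_mul_simple_cancel_left, ← q1] at q2
    have q3 := q2.le_simple_mul hM d2
    rw [simple_mul_simple_cancel_left] at q3
    exact hr (q3.eq_of_length_le (by omega)).symm
  · have q1 := (h3.le_simple_mul hM d3).eq_of_length_le (by omega)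
    have q2 := h2.simple_mul_le_simple_mul hM (i := l) (by
      unfold IsLeftDescent; rw [bl, simple_mul_simple_cancel_left, ← bl]; omega)
    rw [bl, simple_mul_simple_cancel_left, ← q1] at q2
    refine el (BruhatLE.trans ?_ q2)
    apply bruhatLE_simple_mul
    rw [isLeftDescent_simple_iff]
    exact hsl
  · have q1 := (h1.le_simple_mul hM d6).eq_of_length_le (by omega)
    have q2 := (h2.le_simple_mul hM d4).eq_of_length_le (by omega)
    apply er
    rw [q2, ← q1]
    refine BruhatLE.trans ?_ lex
    apply bruhatLE_simple_mul
    rw [isLeftDescent_simple_iff]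
    exact hsr

end CoxeterSystem

namespace CoxeterSystem

variable {B : Type*} {M : CoxeterMatrix B} {W : Type*} [Group W] {cs : CoxeterSystem M W}

/-! ### Regular generators of maximal matchings -/

/-- The map of a matching, extended by the identity. -/
noncomputable def Matching.total (c : cs.Matching) : W → W :=
  @PartialMatching.total W cs.bruhatOrder c

/-- Membership in the domain of a matching. -/
def Matching.Mem (c : cs.Matching) (x : W) : Prop :=
  letI := cs.bruhatOrder
  x ∈ c.dom

theorem eq_of_coatoms_covBy (hM : M.IsSimplyLaced) (a b : W) (ha : 3 ≤ cs.length a)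
    (hb : 3 ≤ cs.length b) (h : letI := cs.bruhatOrder; ∀ z, z ⋖ a ↔ z ⋖ b) : a = b :=
  cs.eq_of_coatoms hM ha hb fun z => by
    rw [← cs.covBy_iff hM, ← cs.covBy_iff hM]; exact h z

/-- A special matching of `W` that commutes with a maximal matching at the identity commutes with
it everywhere. -/
theorem map_mem_and_map_comm (hM : M.IsSimplyLaced) {c : cs.Matching}
    (hc : cs.IsMaximalMatching c) {f : W → W}
    (hf : letI := cs.bruhatOrder; IsMatchingOn Set.univ f)
    (h1 : c.total (f 1) = f (c.total 1)) {x : W} (hx : c.Mem x) :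
    c.Mem (f x) ∧ c.total (f x) = f (c.total x) := by
  let := cs.bruhatOrder
  have hcomm : ∀ x ∈ c.dom, f x ∈ c.dom → c.total (f x) = f (c.total x) := fun x hx hfx =>
    hf.map_comm c.isMatchingOn_total cs.length (cs.length_of_covBy hM) (eq_of_coatoms_covBy hM)
      (fun x _ h0 _ => by
        obtain rfl := cs.length_eq_zero_iff.1 h0
        exact h1) hx hfx
  have hmem : f x ∈ c.dom := PartialMatching.map_mem_of_isMax hc hf cs.length
    (cs.length_of_covBy hM) (cs.exists_le_covBy hM) hcomm hx
  exact ⟨hmem, hcomm x hx hmem⟩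

theorem isLeftRegular_of_total (c : cs.Matching) {i : B}
    (h : ∀ {x}, c.Mem x → c.Mem (cs.simple i * x) ∧
      c.total (cs.simple i * x) = cs.simple i * c.total x) : cs.IsLeftRegular c i := by
  let := cs.bruhatOrder
  refine ⟨fun x hx => (h hx).1, fun x => ?_⟩
  rw [← c.total_coe, ← c.total_coe]
  exact (h x.2).2

theorem isRightRegular_of_total (c : cs.Matching) {i : B}
    (h : ∀ {x}, c.Mem x → c.Mem (x * cs.simple i) ∧
      c.total (x * cs.simple i) = c.total x * cs.simple i) : cs.IsRightRegular c i := by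
  let := cs.bruhatOrder
  refine ⟨fun x hx => (h hx).1, fun x => ?_⟩
  rw [← c.total_coe, ← c.total_coe]
  exact (h x.2).2

theorem IsFull.simple_le {w : W} (hw : cs.IsFull w) (i : B) : cs.BruhatLE (cs.simple i) w := by
  simpa [braidWord, alternatingWord] using (hw i i).2

theorem IsFull.braid_le {w : W} (hw : cs.IsFull w) {i j : B} (h : M i j = 3) :
    cs.BruhatLE (cs.simple i * (cs.simple j * cs.simple i)) w := by
  have := (hw i j).2
  rw [braidWord, h] at this
  rw [cs.simple_braid_of_eq_three h]
  simpa [alternatingWord, wordProd, mul_assoc] using this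

/-- An element of length two above two distinct generators is one of their products. -/
theorem eq_mul_or_of_length_eq_two (hM : M.IsSimplyLaced) {i j : B}
    (hij : cs.simple i ≠ cs.simple j) {y : W} (hy : cs.length y = 2)
    (hi : cs.BruhatLE (cs.simple i) y) (hj : cs.BruhatLE (cs.simple j) y) :
    y = cs.simple i * cs.simple j ∨ y = cs.simple j * cs.simple i := by
  obtain ⟨a, ha⟩ := cs.exists_leftDescent_of_ne_one (w := y) (by rintro rfl; simp at hy)
  have la := cs.isLeftDescent_iff.1 ha
  have key : ∀ b, cs.BruhatLE (cs.simple b) y → cs.simple b ≠ cs.simple a →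
      cs.simple b = cs.simple a * y := fun b hb hne =>
    (hb.le_simple_mul hM (fun h => hne (cs.isLeftDescent_simple_iff.1 h).symm)).eq_of_length_le
      (by rw [length_simple]; omega)
  have hay : y = cs.simple a * (cs.simple a * y) := by simp
  by_cases h1 : cs.simple i = cs.simple a
  · left
    rw [hay, ← key j hj (fun h => hij (h1.trans h.symm)), h1]
  · right
    have h2 := key i hi h1
    by_cases h3 : cs.simple j = cs.simple a
    · rw [hay, ← h2, h3]
    · exact absurd (h2.trans (key j hj h3).symm) hij

end CoxeterSystem

/-! ### Reducibility of maximal matchings -/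

theorem mainTheorem6 {B : Type*} {M : CoxeterMatrix B} {W : Type*} [Group W]
    (cs : CoxeterSystem M W) (hM : M.IsSimplyLaced)
    (c : cs.Matching) (hc : cs.IsMaximalMatching c) :
    cs.IsReducible c := by
  let := cs.bruhatOrder
  refine or_iff_not_imp_left.2 fun hcard => ?_
  rintro ⟨m, hmQ⟩ hm hfull
  obtain ⟨g, hgdef⟩ : ∃ g, g = c.total := ⟨_, rfl⟩
  have hg : IsMatchingOn (c.dom : Set W) g := hgdef ▸ c.isMatchingOn_total
  have hgm : ((c.map ⟨m, hmQ⟩ : c.dom) : W) = g m := by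
    rw [hgdef]
    exact (c.total_of_mem hmQ).symm
  rw [hgm] at hfull
  replace hm : m ⋖ g m := hgm ▸ hm
  change cs.IsReducibleOrbit c m
  have hlen : ∀ {x y : W}, x ⋖ y → cs.length y = cs.length x + 1 := cs.length_of_covBy hM _ _
  have hsQ : ∀ i, cs.simple i ∈ c.dom := fun i => c.dom.lower (hfull.simple_le i) (hg.mem hmQ)
  have h1Q : (1 : W) ∈ c.dom := c.dom.lower (cs.one_bruhatLE _) hmQ
  have h1g : 1 ⋖ g 1 := (hg.covBy_or h1Q).resolve_right fun h => by
    have := hlen h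
    simp at this
  obtain ⟨k, hk⟩ := cs.length_eq_one_iff.1 ((hlen h1g).trans (by simp))
  have hgk : g (cs.simple k) = 1 := by rw [← hk, hg.inv h1Q]
  have hleft : ∀ i, g (cs.simple i) = cs.simple i * cs.simple k →
      ∀ {x}, x ∈ c.dom → cs.simple i * x ∈ c.dom ∧ g (cs.simple i * x) = cs.simple i * g x :=
    fun i hi x hx => by
      subst hgdef
      exact CoxeterSystem.map_mem_and_map_comm hM hc (cs.isMatchingOn_simple_mul hM i)
        (by rw [mul_one]; exact hi.trans (by rw [← hk])) hx
  have hright : ∀ i, g (cs.simple i) = cs.simple k * cs.simple i →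
      ∀ {x}, x ∈ c.dom → x * cs.simple i ∈ c.dom ∧ g (x * cs.simple i) = g x * cs.simple i :=
    fun i hi x hx => by
      subst hgdef
      exact CoxeterSystem.map_mem_and_map_comm hM hc (cs.isMatchingOn_mul_simple hM i)
        (by rw [one_mul]; exact hi.trans (by rw [← hk])) hx
  have hor : ∀ i, g (cs.simple i) = cs.simple i * cs.simple k ∨
      g (cs.simple i) = cs.simple k * cs.simple i := by
    intro i
    by_cases hik : cs.simple i = cs.simple k
    · left; rw [hik, hgk, cs.simple_mul_simple_self]
    have hup : cs.simple i ⋖ g (cs.simple i) := (hg.covBy_or (hsQ i)).resolve_right fun h => by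
      have h2 := hlen h
      rw [cs.length_simple] at h2
      have h3 : g (cs.simple i) = 1 := cs.length_eq_zero_iff.1 (by omega)
      apply hik
      rw [← hk, ← h3, hg.inv (hsQ i)]
    have h1i : (1 : W) ⋖ cs.simple i := (cs.covBy_iff hM).2 ⟨cs.one_bruhatLE _, by simp⟩
    have h2 := hg.map_covBy_map (hsQ i) hup h1i h1g
    rw [hk] at h2
    exact CoxeterSystem.eq_mul_or_of_length_eq_two hM hik ((hlen hup).trans (by simp))
      hup.le h2.le
  by_contra hred
  -- If `m = 1`, then `φ(m) = k` is full, so `k` is the only generator.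
  have hm1 : m ≠ 1 := by
    rintro rfl
    rw [hk] at hfull
    have hsub : Subsingleton B := ⟨fun i j => cs.simple_injective hM
      ((hfull.simple_le i).simple_eq_simple.trans (hfull.simple_le j).simple_eq_simple.symm)⟩
    exact hcard ((ENat.card_le_one_iff_subsingleton B).2 hsub |>.trans one_le_two)
  obtain ⟨l, hl⟩ := cs.exists_leftDescent_of_ne_one hm1
  obtain ⟨r, hr⟩ := cs.exists_rightDescent_of_ne_one hm1
  have hl1 : g (cs.simple l) ≠ cs.simple l * cs.simple k := fun h => hred (Or.inl ⟨l,
    CoxeterSystem.isLeftRegular_of_total c (by subst hgdef; exact hleft l h), hl⟩)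
  have hr1 : g (cs.simple r) ≠ cs.simple k * cs.simple r := fun h => hred (Or.inr ⟨r,
    CoxeterSystem.isRightRegular_of_total c (by subst hgdef; exact hright r h), hr⟩)
  have hl2 := (hor l).resolve_left hl1
  have hr2 := (hor r).resolve_right hr1
  rw [hl2] at hl1
  rw [hr2] at hr1
  have hlr : cs.simple l ≠ cs.simple r := fun he => hl1 (by rw [← hl2, he, hr2])
  have hkk : g (cs.simple k) = cs.simple k * cs.simple k := by
    rw [hgk, cs.simple_mul_simple_self]
  have hkl := cs.mul_eq_three_of_not_comm hM hl1
  have hkr := cs.mul_eq_three_of_not_comm hM hr1.symm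
  have hlen3l := cs.length_simple_mul_simple_mul_simple hM hl1
  have hlen3r := cs.length_simple_mul_simple_mul_simple hM hr1.symm
  have hkl_ne : cs.simple k ≠ cs.simple l := fun h => hl1 (by rw [h])
  have hkr_ne : cs.simple k ≠ cs.simple r := fun h => hr1 (by rw [h])
  have hlen2l := cs.length_simple_mul_simple hkl_ne.symm
  have hlen2r := cs.length_simple_mul_simple hkr_ne
  -- the values of the matching on `l k` and `k r`
  obtain ⟨hlkQ, hlk⟩ := hright k hkk (hsQ l)
  rw [hl2, mul_assoc] at hlk
  obtain ⟨hkrQ, hkr'⟩ := hleft k hkk (hsQ r)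
  rw [hr2] at hkr'
  have hkm : cs.BruhatLE (cs.simple k) m := by
    have h1 : cs.BruhatLE (cs.simple k) (cs.simple l * cs.simple k) := by
      apply cs.bruhatLE_simple_mul
      rw [cs.isLeftDescent_simple_iff]
      exact hkl_ne.symm
    have h2 : cs.BruhatLE (cs.simple l * cs.simple k)
        (cs.simple k * (cs.simple l * cs.simple k)) := by
      apply cs.bruhatLE_simple_mul
      unfold CoxeterSystem.IsLeftDescent
      omega
    -- Fullness enters here: `klk ≤ φ(m)`, so by lifting `klk` or `φ(klk) = lk` lies below `m`.
    rcases hg.le_or_map_le cs.length (cs.length_of_covBy hM) (cs.exists_le_covBy hM) hmQ hm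
      (hfull.braid_le hkl) with h | h
    · exact h1.trans (h2.trans h)
    · rw [← hlk, hg.inv hlkQ] at h
      exact h1.trans h
  have hxm : cs.BruhatLE (cs.simple l * (cs.simple k * cs.simple r)) m :=
    (hkm.mul_simple_le hM hr).simple_mul_le hM hl
  have hxQ := c.dom.lower hxm hmQ
  have hlk_up : cs.simple l * cs.simple k ⋖ g (cs.simple l * cs.simple k) :=
    (hg.covBy_or hlkQ).resolve_right fun h => by
      have := hlen h
      rw [hlk] at this
      omega
  have hkr_up : cs.simple k * cs.simple r ⋖ g (cs.simple k * cs.simple r) :=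
    (hg.covBy_or hkrQ).resolve_right fun h => by
      have := hlen h
      rw [hkr'] at this
      omega
  have hd : ¬ cs.IsLeftDescent (cs.simple k * cs.simple r) l := by
    intro h
    refine (cs.simple_eq_or_of_bruhatLE hM (i := k) (j := r) ((h.simple_le hM).trans ?_)).elim
      hkl_ne.symm hlr
    have := hkr_up.le
    rwa [hkr'] at this
  have hxlen := cs.not_isLeftDescent_iff.1 hd
  have hkr_x : cs.simple k * cs.simple r ⋖ cs.simple l * (cs.simple k * cs.simple r) :=
    (cs.covBy_simple_mul_iff hM).2 hd
  have hlk_x : cs.simple l * cs.simple k ⋖ cs.simple l * (cs.simple k * cs.simple r) := by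
    refine (cs.covBy_iff hM).2 ⟨?_, by omega⟩
    rw [← mul_assoc]
    apply cs.bruhatLE_mul_simple
    unfold CoxeterSystem.IsRightDescent
    rw [mul_assoc]
    omega
  have hx_up : cs.simple l * (cs.simple k * cs.simple r) ⋖
      g (cs.simple l * (cs.simple k * cs.simple r)) := by
    refine (hg.covBy_or hxQ).resolve_right fun h => ?_
    -- If `φ` moved `lkr` down, then `kr` and `lk`, both covered by `lkr` and both moved up, would
    -- equal `φ(lkr)`; but `lk = kr` gives `klk = r`.
    have e1 := hg.eq_of_covBy hxQ h hkr_x hkr_up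
    have e2 := hg.eq_of_covBy hxQ h hlk_x hlk_up
    have e3 : cs.simple k * (cs.simple l * cs.simple k) = cs.simple r := by
      rw [e2, ← e1, cs.simple_mul_simple_cancel_left]
    rw [e3, cs.length_simple] at hlen3l
    omega
  have c1 := hg.map_covBy_map hxQ hx_up hlk_x hlk_up
  have c2 := hg.map_covBy_map hxQ hx_up hkr_x hkr_up
  rw [hlk] at c1
  rw [hkr'] at c2
  have := hlen hx_up
  exact cs.not_exists_common_cover hM hl1 hr1.symm hlr (by omega) hx_up.le c1.le c2.le
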